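/- Let $n \ge 3$ and let $X$ be a real normed space of dimension $n$, with closed unit ball $B_X = \{x \in X : \|x\| \le 1\}$. For a linear subspace $Y \subset X$ let $$\lambda(Y, X) = \inf\{\|P\| : P : X \to Y \text{ bounded linear},\ P y = y \text{ for all } y \in Y\}$$ be its relative projection constant, where $\|P\|$ is the operator norm. Then the following conditions are equivalent. 1. There exists a linear subspace $Y$ of $X$ such that $\dim Y = n-1$ and $\lambda(Y, X) = 2 - \frac{2}{n}$. 2. There exists a linear map $T : X \to \mathbb{R}^n$ such that $C \subset T(B_X) \subset P$, where $C = \{x \in \mathbb{R}^n : |x_1| + |x_2| + \dots + |x_n| \le 1\}$ is the cross-polytope and $$P = \{x \in \mathbb{R}^n : |x_1 + \dots + x_{i-1} - x_i + x_{i+1} + \dots + x_n| \le 1 \text{ for } i = 1, \dots, n\}$$ is the parallelotope bounded by the hyperplanes $x_1 + \dots + x_{i-1} - x_i + x_{i+1} + \dots + x_n = \pm 1$, $i = 1, \dots, n$. -/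

import Mathlib

/-- The set `𝒫(X, Y)` of all projections of `X` onto `Y`: the bounded linear operators `P : X → Y`
with `P y = y` for every `y ∈ Y`. -/
def projections (X : Type*) [NormedAddCommGroup X] [NormedSpace ℝ X] (Y : Submodule ℝ X) :
    Set (X →L[ℝ] Y) :=
  {P | ∀ y : Y, P (y : X) = y}

/-- The relative projection constant `λ(Y, X) = inf {‖P‖ : P ∈ 𝒫(X, Y)}`, with `‖P‖` the operator
norm. (For finite-dimensional `X` the set of projections is never empty.) -/
noncomputable def relProjConst (X : Type*) [NormedAddCommGroup X] [NormedSpace ℝ X]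
    (Y : Submodule ℝ X) : ℝ :=
  sInf {r : ℝ | ∃ P ∈ projections X Y, ‖P‖ = r}

/-- The cross-polytope `C = {x ∈ ℝⁿ : |x₁| + ⋯ + |xₙ| ≤ 1}`. -/
def crossPolytope (n : ℕ) : Set (Fin n → ℝ) :=
  {x | ∑ i, |x i| ≤ 1}

/-- The parallelotope `P ⊆ ℝⁿ` bounded by the hyperplanes
`x₁ + ⋯ + xᵢ₋₁ - xᵢ + xᵢ₊₁ + ⋯ + xₙ = ±1`, for `i = 1, …, n`. -/
def parallelotope (n : ℕ) : Set (Fin n → ℝ) :=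
  {x | ∀ i, |(∑ j ∈ Finset.univ.erase i, x j) - x i| ≤ 1}

/-! A projection onto a hyperplane `Y = ker f` has the form `x ↦ x - f x • w` with `f w = 1`. If it
is minimal and `‖P‖ > 1`, Kolmogorov's criterion and Carathéodory in the dual of `Y` give at most
`n` pairs `(x i, g i)` in the unit balls with `g i (P (x i)) = ‖P‖` and weights making `∑ α i * f (x
i) * g i` vanish on `Y`, hence equal to `c • f`. Averaging gives `‖P‖ = ∑ α i * g i (x i) - c`,
which `card_mul_weighted_trace_sub_le` bounds by `2 - 2 / n`; equality forces `n` pairs with `g i (x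
j) = 1` for `i = j` and `-1` otherwise.

In the coordinates of the basis `x i`, such a system says exactly that the ball lies between the two
polytopes. Conversely, the sandwich supplies the system, and testing any projection on it gives the
lower bound. -/

/-- Bohnenblust's inequality in coordinates: `m i j` is the value of the `i`-th functional at the
`j`-th point, `α` a system of weights, and `f` an eigenvector of the weighted matrix with
eigenvalue `c`. The equality case determines `m`. -/
theorem card_mul_weighted_trace_sub_le {ι : Type*} [Fintype ι] [DecidableEq ι] (n : ℝ) (hcard : (Fintype.card ι : ℝ) ≤ n)
    (hn : 2 ≤ n) (α f : ι → ℝ) (m : ι → ι → ℝ) (c : ℝ) (hα : ∀ i, 0 < α i) (hα1 : ∑ i, α i = 1)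
    (hf : ∀ i, 0 < f i) (hm : ∀ i j, |m i j| ≤ 1) (hc : ∀ j, ∑ i, α i * f i * m i j = c * f j) :
    n * (∑ i, α i * m i i - c) ≤ 2 * n - 2 ∧
    (n * (∑ i, α i * m i i - c) = 2 * n - 2 →
      (Fintype.card ι : ℝ) = n ∧ (∀ i, m i i = 1) ∧ ∀ i j, i ≠ j → m i j = -1) := by
  have hne : Nonempty ι := by
    by_contra h
    rw [not_nonempty_iff] at h
    simp at hα1
  set A := ∑ i, α i * f i with hA
  set F := ∑ i, f i with hF
  set Q := ∑ i, α i ^ 2 * f i with hQ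
  set D := ∑ i, α i * (1 - m i i) with hD
  have hm1 : ∀ i j, m i j ≤ 1 := fun i j => (abs_le.1 (hm i j)).2
  have hm2 : ∀ i j, 0 ≤ 1 + m i j := fun i j => by linarith [(abs_le.1 (hm i j)).1]
  have hAF : A ^ 2 ≤ Q * F := by
    apply Finset.sum_sq_le_sum_mul_sum_of_sq_le_mul
    · intro i _; have := hα i; have := hf i; positivity
    · intro i _; exact (hf i).le
    · intro i _; exact le_of_eq (by ring)
  have hApos : 0 < A := Finset.sum_pos (fun i _ => mul_pos (hα i) (hf i)) Finset.univ_nonempty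
  have hFpos : 0 < F := Finset.sum_pos (fun i _ => hf i) Finset.univ_nonempty
  set σ : ι → ℝ := fun j => ∑ i ∈ Finset.univ.erase j, α i * f i * (1 + m i j) with hσ
  have hσ0 : ∀ j, 0 ≤ σ j := fun j => Finset.sum_nonneg fun i _ =>
    mul_nonneg (mul_pos (hα i) (hf i)).le (hm2 i j)
  -- Column `j` of the eigenvector equation, written with the nonnegative defects `1 - m j j` and `1
  -- + m i j`.
  have key : ∀ j, -c * f j = A - 2 * (α j * f j) + α j * f j * (1 - m j j) - σ j := by
    intro j
    have h1 : α j * f j * (1 + m j j) + σ j = ∑ i, α i * f i * (1 + m i j) :=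
      Finset.add_sum_erase Finset.univ (fun i => α i * f i * (1 + m i j)) (Finset.mem_univ j)
    have h2 : ∑ i, α i * f i * (1 + m i j) = A + c * f j := by
      rw [← hc j, hA, ← Finset.sum_add_distrib]
      exact Finset.sum_congr rfl fun i _ => by ring
    linarith
  have hD1 : ∑ i, α i * m i i = 1 - D := by
    simp only [hD, mul_sub, mul_one, Finset.sum_sub_distrib, hα1]
    ring
  have sum1 : -c * F = Fintype.card ι * A - 2 * A + ∑ j, α j * f j * (1 - m j j) - ∑ j, σ j := by
    rw [hF, Finset.mul_sum, Finset.sum_congr rfl fun j _ => key j]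
    simp [Finset.sum_sub_distrib, Finset.sum_add_distrib, ← Finset.mul_sum, ← hA]
  have sum2 : -c * A = A - 2 * Q + ∑ j, α j * (α j * f j * (1 - m j j)) - ∑ j, α j * σ j := by
    have e : -c * A = ∑ j, α j * (-c * f j) := by
      rw [hA, Finset.mul_sum]; exact Finset.sum_congr rfl fun i _ => by ring
    rw [e, Finset.sum_congr rfl fun j _ => by rw [key j]]
    have e2 : ∀ j, α j * (A - 2 * (α j * f j) + α j * f j * (1 - m j j) - σ j) =
      α j * A - 2 * (α j ^ 2 * f j) + α j * (α j * f j * (1 - m j j)) - α j * σ j := fun j => by ring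
    simp [e2, Finset.sum_sub_distrib, Finset.sum_add_distrib, ← Finset.mul_sum, ← Finset.sum_mul,
      hα1, ← hQ]
  have hfF : ∀ j, f j ≤ F := fun j => Finset.single_le_sum (fun i _ => (hf i).le) (Finset.mem_univ j)
  have hfA : ∀ j, α j * f j ≤ A := fun j =>
    Finset.single_le_sum (f := fun i => α i * f i) (fun i _ => (mul_pos (hα i) (hf i)).le)
      (Finset.mem_univ j)
  have hδ : ∀ j, 0 ≤ α j * (1 - m j j) := fun j =>
    mul_nonneg (hα j).le (by linarith [hm1 j j])
  have d1 : F * D - ∑ j, α j * f j * (1 - m j j) = ∑ j, (F - f j) * (α j * (1 - m j j)) := by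
    rw [hD, Finset.mul_sum, ← Finset.sum_sub_distrib]
    exact Finset.sum_congr rfl fun i _ => by ring
  have d1' : ∀ j, 0 ≤ (F - f j) * (α j * (1 - m j j)) := fun j =>
    mul_nonneg (by linarith [hfF j]) (hδ j)
  have d1s := Finset.sum_nonneg fun j (_ : j ∈ Finset.univ) => d1' j
  have d2 : ∑ j, α j * (α j * f j * (1 - m j j)) ≤ A * D := by
    rw [hD, Finset.mul_sum]
    refine Finset.sum_le_sum fun j _ => ?_
    nlinarith [mul_le_mul_of_nonneg_right (hfA j) (hδ j)]
  have s1 := Finset.sum_nonneg fun j (_ : j ∈ Finset.univ) => hσ0 j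
  have s2 := Finset.sum_nonneg fun j (_ : j ∈ Finset.univ) => mul_nonneg (hα j).le (hσ0 j)
  -- The weighted sum with Cauchy–Schwarz gives `k2`, the plain sum `k1`; twice `k1` plus `n - 2`
  -- times `k2` cancels `A`.
  have k2 : (-c - D) * F ≤ F - 2 * A := by
    have h : (-c - D) * A ≤ A - 2 * Q := by linarith
    have h3 : (-c - D) * F * A ≤ (F - 2 * A) * A := by nlinarith
    exact le_of_mul_le_mul_right h3 hApos
  have k1 : (-c - D) * F = (Fintype.card ι - 2) * A - ∑ j, (F - f j) * (α j * (1 - m j j))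
      - ∑ j, σ j := by linarith
  have hnA : (Fintype.card ι - 2) * A ≤ (n - 2) * A :=
    mul_le_mul_of_nonneg_right (by linarith) hApos.le
  have k2' := mul_le_mul_of_nonneg_left k2 (by linarith : 0 ≤ n - 2)
  rw [hD1]
  constructor
  · have : n * (-c - D) * F ≤ (n - 2) * F := by linarith
    have := le_of_mul_le_mul_right this hFpos
    linarith
  · intro h
    have e : n * (-c - D) * F = (n - 2) * F := by congr 1; linarith
    have k3 : (n - 2) * A ≤ (-c - D) * F := by linarith
    have z1 : ∑ j, (F - f j) * (α j * (1 - m j j)) = 0 := by linarith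
    have z2 : ∑ j, σ j = 0 := by linarith
    have z3 : Fintype.card ι * A = n * A := by linarith
    have hcn := mul_right_cancel₀ hApos.ne' z3
    refine ⟨hcn, fun i => ?_, fun i j hij => ?_⟩
    · have := (Finset.sum_eq_zero_iff_of_nonneg fun j _ => d1' j).1 z1 i (Finset.mem_univ i)
      have hnt : Nontrivial ι := by
        rw [← Fintype.one_lt_card_iff_nontrivial]
        have : (1 : ℝ) < Fintype.card ι := by linarith
        exact_mod_cast this
      obtain ⟨j, hj⟩ := exists_ne i
      have hlt : f i < F := Finset.single_lt_sum hj (Finset.mem_univ i) (Finset.mem_univ j) (hf j)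
        fun k _ _ => (hf k).le
      rcases mul_eq_zero.1 this with h | h
      · linarith
      · rcases mul_eq_zero.1 h with h | h
        · linarith [hα i]
        · linarith
    · have h1 := (Finset.sum_eq_zero_iff_of_nonneg fun j _ => hσ0 j).1 z2 j (Finset.mem_univ j)
      have h2 := (Finset.sum_eq_zero_iff_of_nonneg fun i _ =>
        mul_nonneg (mul_pos (hα i) (hf i)).le (hm2 i j)).1 h1 i (by simp [hij])
      rcases mul_eq_zero.1 h2 with h | h
      · exact absurd h (mul_pos (hα i) (hf i)).ne'
      · linarith

/-! ### Convexity and best approximation -/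

/-- In finite dimension the convex hull of a compact set is compact, by Carathéodory. -/
theorem IsCompact.convexHull_of_finiteDimensional {E : Type*} [AddCommGroup E] [Module ℝ E]
    [TopologicalSpace E] [IsTopologicalAddGroup E] [ContinuousSMul ℝ E] [FiniteDimensional ℝ E]
    {s : Set E} (hs : IsCompact s) : IsCompact (convexHull ℝ s) := by
  have h : convexHull ℝ s = ⋃ m ∈ Finset.range (Module.finrank ℝ E + 2),
      (fun p : (Fin m → ℝ) × (Fin m → E) => ∑ i, p.1 i • p.2 i) ''
        (stdSimplex ℝ (Fin m) ×ˢ Set.univ.pi fun _ => s) := by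
    ext x
    simp only [Set.mem_iUnion, Set.mem_image, Set.mem_prod, Prod.exists, Finset.mem_range]
    constructor
    · intro hx
      obtain ⟨ι, _, z, w, hz, hind, hw, hw1, hx⟩ := eq_pos_convex_span_of_mem_convexHull hx
      have hcard := hind.card_le_finrank_succ
      have hle := Submodule.finrank_le (vectorSpan ℝ (Set.range z))
      let e := (Fintype.equivFin ι).symm
      refine ⟨Fintype.card ι, by omega, w ∘ e, z ∘ e, ⟨⟨fun i => (hw _).le, ?_⟩,
        fun i _ => hz ⟨_, rfl⟩⟩, ?_⟩
      · rw [← hw1]; exact e.sum_comp w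
      · rw [← hx]; exact e.sum_comp fun i => w i • z i
    · rintro ⟨m, -, w, z, ⟨⟨hw, hw1⟩, hz⟩, rfl⟩
      exact (convex_convexHull ℝ s).sum_mem (fun i _ => hw i) hw1
        fun i _ => subset_convexHull ℝ s (hz i trivial)
  rw [h]
  refine Finset.isCompact_biUnion _ fun m _ => IsCompact.image ?_ (by fun_prop)
  exact (isCompact_stdSimplex ℝ (Fin m)).prod (isCompact_univ_pi fun _ => hs)

/-- Finite-dimensional spaces are reflexive. -/
theorem exists_eval_eq_of_dual_dual {Y : Type*} [NormedAddCommGroup Y] [NormedSpace ℝ Y]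
    [FiniteDimensional ℝ Y] (u : StrongDual ℝ (StrongDual ℝ Y)) :
    ∃ h : Y, ∀ g : StrongDual ℝ Y, u g = g h := by
  let e : Module.Dual ℝ Y →ₗ[ℝ] StrongDual ℝ Y := (LinearMap.toContinuousLinearMap).toLinearMap
  obtain ⟨h, hh⟩ := (Module.evalEquiv ℝ Y).surjective (u.toLinearMap ∘ₗ e)
  refine ⟨h, fun g => ?_⟩
  have := LinearMap.congr_fun hh (g : Y →ₗ[ℝ] ℝ)
  simp only [Module.evalEquiv_apply] at this
  exact this.symm

/-- Kolmogorov's criterion for best approximation of `P` by the operators `x ↦ f x • h`. -/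
theorem zero_mem_convexHull_contact {X : Type*} [NormedAddCommGroup X] [NormedSpace ℝ X]
    [FiniteDimensional ℝ X] {Y : Type*} [NormedAddCommGroup Y] [NormedSpace ℝ Y]
    [FiniteDimensional ℝ Y] (P : X →L[ℝ] Y) (f : StrongDual ℝ X)
    (hmin : ∀ h : Y, ‖P‖ ≤ ‖P - f.smulRight h‖) :
    (0 : StrongDual ℝ Y) ∈ convexHull ℝ {φ | ∃ (x : X) (g : StrongDual ℝ Y),
      ‖x‖ ≤ 1 ∧ ‖g‖ ≤ 1 ∧ g (P x) = ‖P‖ ∧ φ = f x • g} := by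
  set K := {φ | ∃ (x : X) (g : StrongDual ℝ Y), ‖x‖ ≤ 1 ∧ ‖g‖ ≤ 1 ∧ g (P x) = ‖P‖ ∧ φ = f x • g}
    with hK
  have : ProperSpace (StrongDual ℝ Y) := FiniteDimensional.proper ℝ _
  have hball : IsCompact (Metric.closedBall (0 : X) 1 ×ˢ Metric.closedBall (0 : StrongDual ℝ Y) 1) :=
    (isCompact_closedBall _ _).prod (isCompact_closedBall _ _)
  have hcP : Continuous fun p : X × StrongDual ℝ Y => p.2 (P p.1) := by fun_prop
  have hKc : IsCompact K := by
    have hc : Continuous fun p : X × StrongDual ℝ Y => f p.1 • p.2 := by fun_prop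
    convert (hball.inter_right (isClosed_eq hcP (continuous_const (y := ‖P‖)))).image hc using 1
    ext φ
    simp only [hK, Set.mem_ofPred_eq, Set.mem_image, Set.mem_inter_iff, Set.mem_prod,
      mem_closedBall_zero_iff, Prod.exists]
    exact ⟨fun ⟨x, g, a, b, c, d⟩ => ⟨x, g, ⟨⟨a, b⟩, c⟩, d.symm⟩,
      fun ⟨x, g, ⟨⟨a, b⟩, c⟩, d⟩ => ⟨x, g, a, b, c, d.symm⟩⟩
  by_contra h0
  obtain ⟨u, s, hs0, hs⟩ := geometric_hahn_banach_point_closed (convex_convexHull ℝ K)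
    hKc.convexHull_of_finiteDimensional.isClosed h0
  rw [map_zero] at hs0
  obtain ⟨h, hh⟩ := exists_eval_eq_of_dual_dual u
  have hle : ∀ (x : X) (g : StrongDual ℝ Y), ‖x‖ ≤ 1 → ‖g‖ ≤ 1 → g (P x) ≤ ‖P‖ := by
    intro x g hx hg
    calc g (P x) ≤ ‖g (P x)‖ := Real.le_norm_self _
      _ ≤ ‖g‖ * (‖P‖ * ‖x‖) := g.le_opNorm_of_le (P.le_opNorm x)
      _ ≤ 1 * (‖P‖ * 1) := by gcongr
      _ = ‖P‖ := by ring
  have hch : Continuous fun p : X × StrongDual ℝ Y => f p.1 * p.2 h := by fun_prop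
  -- Contact pairs satisfy `f x * g h > s`, so on the compact set of remaining pairs the maximum `m`
  -- of `g (P x)` stays below `‖P‖`.
  obtain ⟨⟨x₀, g₀⟩, hM, hmax⟩ := (hball.inter_right
    (isClosed_le hch (continuous_const (y := s)))).exists_isMaxOn
    ⟨(0, 0), by simp [hs0.le]⟩ hcP.continuousOn
  set m := g₀ (P x₀) with hm
  have hm0 : 0 ≤ m := by
    have := hmax (a := (0, 0)) (by simp [hs0.le])
    simpa using this
  simp only [Set.mem_inter_iff, Set.mem_prod, mem_closedBall_zero_iff, Set.mem_ofPred_eq] at hM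
  have hmP : m < ‖P‖ := by
    refine lt_of_le_of_ne (hle _ _ hM.1.1 hM.1.2) fun he => ?_
    have := hs _ (subset_convexHull ℝ K ⟨x₀, g₀, hM.1.1, hM.1.2, he, rfl⟩)
    rw [hh] at this
    simp only [smul_apply, smul_eq_mul] at this
    linarith [hM.2]
  set C := ‖f‖ * ‖h‖ + 1 with hC
  have hCpos : 0 < C := by positivity
  -- Subtracting `t • f.smulRight h` gains at least `t * s` where `f x * g h > s`, and elsewhere
  -- loses at most half the gap `‖P‖ - m`.
  set t := (‖P‖ - m) / (2 * C) with ht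
  have htpos : 0 < t := div_pos (by linarith) (by linarith)
  have htC : t * C = (‖P‖ - m) / 2 := by rw [ht]; field_simp
  set Q : X →L[ℝ] Y := P - t • f.smulRight h with hQ
  have hPQ : ‖P‖ ≤ ‖Q‖ := by
    have := hmin (t • h)
    have e : f.smulRight (t • h) = t • f.smulRight h := by
      ext x
      exact smul_comm (f x) t h
    rwa [e] at this
  have hlt : ‖Q‖ ≤ max (m + t * C) (‖P‖ - t * s) := by
    refine Q.opNorm_le_of_unit_norm (le_max_of_le_left (by positivity)) fun x hx => ?_
    obtain ⟨g, hg, hgx⟩ := exists_dual_vector'' ℝ (Q x)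
    have hgx' : ‖Q x‖ = g (P x) - t * (f x * g h) := by
      have : g (Q x) = ‖Q x‖ := hgx
      rw [← this]
      change g (P x - t • (f x • h)) = _
      rw [map_sub, map_smul, map_smul, smul_eq_mul, smul_eq_mul]
    rw [hgx']
    by_cases hc : f x * g h ≤ s
    · refine le_max_of_le_left ?_
      have h1 : g (P x) ≤ m := hmax (a := (x, g)) (by simp [hx, hg, hc])
      have h2 : -(f x * g h) ≤ C := by
        have : ‖f x * g h‖ ≤ (‖f‖ * 1) * (1 * ‖h‖) := by
          rw [norm_mul]
          gcongr
          · exact f.le_of_opNorm_le_of_le le_rfl hx.le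
          · exact g.le_of_opNorm_le hg h
        have := neg_le_of_abs_le this
        linarith
      nlinarith
    · refine le_max_of_le_right ?_
      have := hle x g hx.le hg
      nlinarith
  have : max (m + t * C) (‖P‖ - t * s) < ‖P‖ :=
    max_lt (by linarith) (by nlinarith)
  linarith

/-! ### Minimal projections onto hyperplanes -/

theorem exists_norm_le_of_isClosed {X Y : Type*} [NormedAddCommGroup X] [NormedSpace ℝ X]
    [FiniteDimensional ℝ X] [NormedAddCommGroup Y] [NormedSpace ℝ Y] [FiniteDimensional ℝ Y]
    {s : Set (X →L[ℝ] Y)} (hcl : IsClosed s) (hne : s.Nonempty) :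
    ∃ P ∈ s, ∀ Q ∈ s, ‖P‖ ≤ ‖Q‖ := by
  have : ProperSpace (X →L[ℝ] Y) := FiniteDimensional.proper ℝ _
  obtain ⟨P, hP, hd⟩ := hcl.exists_infDist_eq_dist hne 0
  refine ⟨P, hP, fun Q hQ => ?_⟩
  have := Metric.infDist_le_dist_of_mem hQ (x := 0)
  rwa [hd, dist_zero_left, dist_zero_left] at this

/-- The relative projection constant is attained. -/
theorem exists_isLeast_norm_projections {X : Type*} [NormedAddCommGroup X] [NormedSpace ℝ X]
    [FiniteDimensional ℝ X] (Y : Submodule ℝ X) :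
    ∃ P ∈ projections X Y, (∀ Q ∈ projections X Y, ‖P‖ ≤ ‖Q‖) ∧ relProjConst X Y = ‖P‖ := by
  have hcl : IsClosed (projections X Y) := by
    have : projections X Y = ⋂ y : Y, {P | P (y : X) = y} := by
      ext P
      simp [projections]
    rw [this]
    exact isClosed_iInter fun y => isClosed_eq (by fun_prop) continuous_const
  have hne : (projections X Y).Nonempty := by
    obtain ⟨p, hp⟩ := Y.subtype.exists_leftInverse_of_injective Y.ker_subtype
    exact ⟨LinearMap.toContinuousLinearMap p, fun y => LinearMap.congr_fun hp y⟩
  obtain ⟨P, hP, hmin⟩ := exists_norm_le_of_isClosed hcl hne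
  exact ⟨P, hP, hmin, IsLeast.csInf_eq ⟨⟨P, hP, rfl⟩, by rintro _ ⟨Q, hQ, rfl⟩; exact hmin Q hQ⟩⟩

/-- A minimal projection onto a hyperplane has norm at most `2 - 2 / n`, and equality forces a
system of points and functionals with `g i (x j) = ±1`. -/
theorem minimal_projection_ker {X : Type*} [NormedAddCommGroup X] [NormedSpace ℝ X]
    [FiniteDimensional ℝ X] {n : ℕ} (hn : 3 ≤ n) (hX : Module.finrank ℝ X = n)
    {Y : Submodule ℝ X} {f : StrongDual ℝ X} (hf : f ≠ 0) (hY : ∀ x, x ∈ Y ↔ f x = 0)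
    {P : X →L[ℝ] Y} (hP : P ∈ projections X Y) (hmin : ∀ Q ∈ projections X Y, ‖P‖ ≤ ‖Q‖) :
    ‖P‖ ≤ 2 - 2 / (n : ℝ) ∧ (‖P‖ = 2 - 2 / (n : ℝ) →
      ∃ (x : Fin n → X) (g : Fin n → StrongDual ℝ X), (∀ i, ‖x i‖ ≤ 1) ∧ (∀ i, ‖g i‖ ≤ 1) ∧
        (∀ i, g i (x i) = 1) ∧ ∀ i j, i ≠ j → g i (x j) = -1) := by
  have hn' : (3 : ℝ) ≤ n := by exact_mod_cast hn
  have hgt : 1 < 2 - 2 / (n : ℝ) := by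
    have : 2 / (n : ℝ) < 1 := by rw [div_lt_one] <;> linarith
    linarith
  -- `‖P‖ > 1` keeps contact points off `Y`, where `P` is the identity.
  by_cases hP1 : ‖P‖ ≤ 1
  · exact ⟨by linarith, fun h => by linarith⟩
  push Not at hP1
  have hYn : Module.finrank ℝ Y + 1 = n := by
    have hYk : Y = LinearMap.ker (f : Module.Dual ℝ X) := by
      ext x
      simp [hY]
    rw [hYk, ← hX]
    exact Module.Dual.finrank_ker_add_one_of_ne_zero fun h => hf (ContinuousLinearMap.coe_injective h)
  obtain ⟨w₀, hw₀⟩ : ∃ w₀, f w₀ = 1 := by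
    obtain ⟨v, hv⟩ : ∃ v, f v ≠ 0 := by
      by_contra! h
      exact hf (ContinuousLinearMap.ext h)
    exact ⟨(f v)⁻¹ • v, by simp [hv]⟩
  have hfP : ∀ x, f (P x) = 0 := fun x => (hY _).1 (P x).2
  set w := w₀ - P w₀ with hw
  have hfw : f w = 1 := by simp [hw, hw₀, hfP]
  have hPw : P w = 0 := by rw [hw, map_sub, hP, sub_self]
  have hPx : ∀ x, (P x : X) = x - f x • w := by
    intro x
    have h1 : x - f x • w ∈ Y := (hY _).2 (by simp [hfw])
    have h2 := hP ⟨_, h1⟩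
    rw [map_sub, map_smul, hPw, smul_zero, sub_zero] at h2
    rw [h2]
  clear_value w
  have h0 := zero_mem_convexHull_contact P f fun h => hmin _ fun y => by
    rw [sub_apply, hP y, ContinuousLinearMap.smulRight_apply, (hY _).1 y.2, zero_smul, sub_zero]
  obtain ⟨ι, _, φ, α, hφ, hind, hα, hα1, hsum⟩ := eq_pos_convex_span_of_mem_convexHull h0
  have hcard : Fintype.card ι ≤ n := by
    have h1 := hind.card_le_finrank_succ
    have h2 := Submodule.finrank_le (vectorSpan ℝ (Set.range φ))
    have h3 : Module.finrank ℝ (StrongDual ℝ Y) = Module.finrank ℝ Y := by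
      rw [← Subspace.dual_finrank_eq (K := ℝ) (V := Y)]
      exact (LinearMap.toContinuousLinearMap (𝕜 := ℝ) (E := Y) (F' := ℝ)).finrank_eq.symm
    omega
  have hcontact : ∀ i, ∃ (x : X) (g : StrongDual ℝ X), ‖x‖ ≤ 1 ∧ ‖g‖ ≤ 1 ∧ g (P x) = ‖P‖ ∧
      0 < f x ∧ ∀ y : Y, φ i y = f x * g y := by
    intro i
    obtain ⟨x, g, hx, hg, hgx, hφi⟩ := hφ ⟨i, rfl⟩
    obtain ⟨G, hG, hGn⟩ := exists_extension_norm_eq Y g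
    have hfx : f x ≠ 0 := by
      intro h
      have h1 : (P x : X) = x := by rw [hPx, h, zero_smul, sub_zero]
      have h2 : G x = ‖P‖ := by rw [← hgx, ← hG, h1]
      have h3 : G x ≤ 1 := (Real.le_norm_self _).trans
        ((G.le_of_opNorm_le_of_le (hGn.le.trans hg) hx).trans (by norm_num))
      linarith
    -- Negating both `x` and the functional preserves `f x • g`, so `f x` may be taken positive.
    rcases hfx.lt_or_gt with h | h
    · refine ⟨-x, -G, by simpa using hx, by rw [norm_neg, hGn]; exact hg, ?_, by simpa using h, ?_⟩
      · rw [← hgx, ← hG]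
        simp
      · intro y
        rw [hφi]
        simp [hG]
    · refine ⟨x, G, hx, hGn.le.trans hg, by rw [← hgx, ← hG], h, fun y => ?_⟩
      rw [hφi]
      simp [hG]
  choose x g hx hg hgx hfx hφx using hcontact
  have hbal : ∀ y : Y, ∑ i, α i * f (x i) * g i y = 0 := by
    intro y
    have := DFunLike.congr_fun hsum y
    simpa [hφx, mul_assoc, sum_apply] using this
  set c := ∑ i, α i * f (x i) * g i w with hc
  have hcf : ∀ z, ∑ i, α i * f (x i) * g i z = c * f z := by
    intro z
    have := hbal (P z)
    simp only [hPx, map_sub, map_smul, smul_eq_mul, mul_sub, Finset.sum_sub_distrib] at this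
    rw [sub_eq_zero.1 this, hc, Finset.sum_mul]
    exact Finset.sum_congr rfl fun i _ => by ring
  have hval : ∑ i, α i * g i (x i) - c = ‖P‖ := by
    rw [hc, ← Finset.sum_sub_distrib]
    calc _ = ∑ i, α i * ‖P‖ := Finset.sum_congr rfl fun i _ => by
          rw [← hgx i, hPx, map_sub, map_smul, smul_eq_mul]; ring
      _ = ‖P‖ := by rw [← Finset.sum_mul, hα1, one_mul]
  classical
  obtain ⟨hle, heq⟩ := card_mul_weighted_trace_sub_le (n : ℝ) (by exact_mod_cast hcard) (by linarith) α
    (fun i => f (x i)) (fun i j => g i (x j)) c hα hα1 hfx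
    (fun i j => ((g i).le_of_opNorm_le_of_le (hg i) (hx j)).trans (by norm_num)) fun j => hcf _
  rw [hval] at hle heq
  have hn0 : (0 : ℝ) < n := by linarith
  constructor
  · rw [← mul_le_mul_iff_right₀ hn0]
    refine hle.trans (le_of_eq ?_)
    field_simp
  · intro h
    obtain ⟨h1, h2, h3⟩ := heq (by rw [h]; field_simp)
    let e := (Fintype.equivFinOfCardEq (by exact_mod_cast h1 : Fintype.card ι = n)).symm
    exact ⟨x ∘ e, g ∘ e, fun i => hx _, fun i => hg _, fun i => h2 _,
      fun i j hij => h3 _ _ (e.injective.ne hij)⟩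

/-! ### Contact systems and the two polytopes -/

theorem sum_erase_sub_self {ι : Type*} [Fintype ι] [DecidableEq ι] (v : ι → ℝ) (i : ι) :
    (∑ j ∈ Finset.univ.erase i, v j) - v i = ∑ j, v j - 2 * v i := by
  rw [Finset.sum_erase_eq_sub (Finset.mem_univ i)]
  ring

theorem exists_linearMap_of_contact_system {X : Type*} [NormedAddCommGroup X] [NormedSpace ℝ X]
    [FiniteDimensional ℝ X] {n : ℕ} (hn : n ≠ 2) (hX : Module.finrank ℝ X = n)
    {x : Fin n → X} {g : Fin n → StrongDual ℝ X} (hx : ∀ i, ‖x i‖ ≤ 1) (hg : ∀ i, ‖g i‖ ≤ 1)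
    (hgx : ∀ i, g i (x i) = 1) (hgx' : ∀ i j, i ≠ j → g i (x j) = -1) :
    ∃ T : X →ₗ[ℝ] (Fin n → ℝ), crossPolytope n ⊆ T '' Metric.closedBall (0 : X) 1 ∧
      T '' Metric.closedBall (0 : X) 1 ⊆ parallelotope n := by
  let S : (Fin n → ℝ) →ₗ[ℝ] X := Fintype.linearCombination ℝ x
  have hS : ∀ v, S v = ∑ i, v i • x i := fun v => Fintype.linearCombination_apply ℝ x v
  have hgS : ∀ i v, g i (S v) = -(∑ j, v j - 2 * v i) := by
    intro i v
    rw [← sum_erase_sub_self, hS, map_sum, ← Finset.add_sum_erase _ _ (Finset.mem_univ i),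
      Finset.sum_congr rfl fun j hj => by
        rw [map_smul, hgx' i j (Finset.ne_of_mem_erase hj).symm, smul_eq_mul, mul_neg_one]]
    rw [map_smul, hgx, smul_eq_mul, Finset.sum_neg_distrib]
    ring
  -- On the kernel each coordinate is half the total, so the total is `n / 2` times itself; this is
  -- where `n ≠ 2` enters.
  have hinj : Function.Injective S := by
    rw [← LinearMap.ker_eq_bot, LinearMap.ker_eq_bot']
    intro v hv
    have h1 : ∀ i, v i = (∑ j, v j) / 2 := fun i => by
      have := hgS i v
      rw [hv, map_zero] at this
      linarith
    have h2 : ∑ j, v j = n * ((∑ j, v j) / 2) := by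
      conv_lhs => rw [Finset.sum_congr rfl fun i _ => h1 i]
      simp
    have h3 : ((n : ℝ) - 2) * ∑ j, v j = 0 := by linarith
    have h4 : (n : ℝ) - 2 ≠ 0 := sub_ne_zero.2 (by exact_mod_cast hn)
    have h5 := (mul_eq_zero.1 h3).resolve_left h4
    ext i
    rw [h1 i, h5, zero_div, Pi.zero_apply]
  let e := LinearEquiv.ofInjectiveOfFinrankEq S hinj (by simp [hX])
  have he : ∀ v, e v = S v := fun v => rfl
  refine ⟨e.symm, ?_, ?_⟩
  · intro v hv
    refine ⟨S v, ?_, by simp [← he]⟩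
    rw [mem_closedBall_zero_iff, hS]
    refine (norm_sum_le _ _).trans (le_trans (Finset.sum_le_sum fun i _ => ?_) hv)
    rw [norm_smul]
    exact mul_le_of_le_one_right (norm_nonneg _) (hx i)
  · rintro _ ⟨z, hz, rfl⟩ i
    have h := hgS i (e.symm z)
    rw [← he, e.apply_symm_apply] at h
    rw [mem_closedBall_zero_iff] at hz
    rw [sum_erase_sub_self, ← abs_neg]
    change |-(∑ j, e.symm z j - 2 * e.symm z i)| ≤ 1
    rw [← h]
    exact ((g i).le_of_opNorm_le_of_le (hg i) hz).trans (by norm_num)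

/-- Take `f` the sum of the coordinates of `T` and `g i = f - 2 T_i`, of norm at most 1 by the
parallelotope bound. On preimages `x i` of the unit vectors, `g i (P (x i)) = -2 (1 - T w i)`; since
`∑ T w i = 1`, averaging over `i` gives `‖P‖ ≥ 2 - 2 / n`. -/
theorem exists_relProjConst_eq_of_linearMap {X : Type*} [NormedAddCommGroup X] [NormedSpace ℝ X]
    [FiniteDimensional ℝ X] {n : ℕ} (hn : 3 ≤ n) (hX : Module.finrank ℝ X = n)
    {T : X →ₗ[ℝ] (Fin n → ℝ)} (hC : crossPolytope n ⊆ T '' Metric.closedBall (0 : X) 1)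
    (hT : T '' Metric.closedBall (0 : X) 1 ⊆ parallelotope n) :
    ∃ Y : Submodule ℝ X, Module.finrank ℝ Y = n - 1 ∧ relProjConst X Y = 2 - 2 / (n : ℝ) := by
  have hn' : (3 : ℝ) ≤ n := by exact_mod_cast hn
  have hvert : ∀ i : Fin n, ∃ x : X, ‖x‖ ≤ 1 ∧ T x = Pi.single i 1 := by
    intro i
    obtain ⟨x, hx, h⟩ := hC (a := Pi.single i 1) (by simp [crossPolytope, Pi.single_apply, apply_ite abs])
    exact ⟨x, mem_closedBall_zero_iff.1 hx, h⟩
  choose x hx hTx using hvert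
  let f : StrongDual ℝ X := LinearMap.toContinuousLinearMap
    ((∑ i, LinearMap.proj i : (Fin n → ℝ) →ₗ[ℝ] ℝ) ∘ₗ T)
  have hf : ∀ z, f z = ∑ i, T z i := fun z => by simp [f]
  have hfx : ∀ i, f (x i) = 1 := fun i => by simp [hf, hTx]
  let g : Fin n → StrongDual ℝ X := fun i =>
    f - (2 : ℝ) • LinearMap.toContinuousLinearMap (LinearMap.proj i ∘ₗ T)
  have hgz : ∀ i z, g i z = f z - 2 * T z i := fun i z => rfl
  have hg : ∀ i, ‖g i‖ ≤ 1 := fun i => by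
    refine (g i).opNorm_le_of_unit_norm zero_le_one fun z hz => ?_
    have := hT ⟨z, mem_closedBall_zero_iff.2 hz.le, rfl⟩ i
    rw [sum_erase_sub_self, ← hf, ← hgz] at this
    exact this
  let i₀ : Fin n := ⟨0, by omega⟩
  have hf0 : f ≠ 0 := fun h => by
    have := hfx i₀
    simp [h] at this
  let Y : Submodule ℝ X := LinearMap.ker (f : Module.Dual ℝ X)
  have hY : ∀ z, z ∈ Y ↔ f z = 0 := fun z => LinearMap.mem_ker
  have hYn : Module.finrank ℝ Y + 1 = Module.finrank ℝ X :=
    Module.Dual.finrank_ker_add_one_of_ne_zero fun h => hf0 (ContinuousLinearMap.coe_injective h)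
  obtain ⟨P, hP, hmin, hPY⟩ := exists_isLeast_norm_projections Y
  refine ⟨Y, by omega, ?_⟩
  rw [hPY]
  refine le_antisymm (minimal_projection_ker hn hX hf0 hY hP hmin).1 ?_
  set w := x i₀ - P (x i₀) with hw
  have hPx : ∀ i, (P (x i) : X) = x i - w := by
    intro i
    have h1 : x i - x i₀ ∈ Y := (hY _).2 (by rw [map_sub, hfx, hfx, sub_self])
    have h2 := congrArg (Subtype.val) (hP ⟨_, h1⟩)
    simp only [map_sub, AddSubgroupClass.coe_sub] at h2
    rw [hw, ← sub_add, ← h2]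
    abel
  have hfw : f w = 1 := by
    rw [hw, map_sub, hfx, (hY _).1 (P (x i₀)).2, sub_zero]
  have hle : ∀ i, 2 * (1 - T w i) ≤ ‖P‖ := by
    intro i
    have h1 : g i (P (x i)) = -(2 * (1 - T w i)) := by
      rw [hgz, (hY _).1 (P (x i)).2, hPx, map_sub, hTx, Pi.sub_apply, Pi.single_eq_same]
      ring
    have h2 : ‖g i (P (x i))‖ ≤ 1 * (‖P‖ * 1) :=
      (g i).le_of_opNorm_le_of_le (hg i) (P.le_opNorm_of_le (hx i))
    rw [h1, norm_neg] at h2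
    have := Real.le_norm_self (2 * (1 - T w i))
    linarith
  have hsum := Finset.sum_le_sum fun i (_ : i ∈ Finset.univ) => hle i
  rw [← Finset.mul_sum, Finset.sum_sub_distrib, ← hf, hfw] at hsum
  simp only [Finset.sum_const, Finset.card_univ, Fintype.card_fin, nsmul_eq_mul, mul_one] at hsum
  have hn0 : (0 : ℝ) < n := by linarith
  rw [← mul_le_mul_iff_right₀ hn0]
  refine le_trans (le_of_eq ?_) hsum
  field_simp

theorem corollary2p6 (n : ℕ) (hn : 3 ≤ n) (X : Type*) [NormedAddCommGroup X] [NormedSpace ℝ X]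
    (hX : Module.finrank ℝ X = n) :
    (∃ Y : Submodule ℝ X, Module.finrank ℝ Y = n - 1 ∧ relProjConst X Y = 2 - 2 / (n : ℝ)) ↔
      ∃ T : X →ₗ[ℝ] (Fin n → ℝ),
        crossPolytope n ⊆ T '' Metric.closedBall (0 : X) 1 ∧
          T '' Metric.closedBall (0 : X) 1 ⊆ parallelotope n := by
  have : FiniteDimensional ℝ X := FiniteDimensional.of_finrank_pos (by omega)
  constructor
  · rintro ⟨Y, hYn, hYc⟩
    have hlt : Y < ⊤ := lt_top_iff_ne_top.2 fun h => by
      rw [h, finrank_top] at hYn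
      omega
    obtain ⟨f, hf0, hYf⟩ := Submodule.exists_le_ker_of_lt_top Y hlt
    have hker := Module.Dual.finrank_ker_add_one_of_ne_zero hf0
    have hYeq : Y = LinearMap.ker f := Submodule.eq_of_le_of_finrank_eq hYf (by omega)
    obtain ⟨P, hP, hmin, hPY⟩ := exists_isLeast_norm_projections Y
    obtain ⟨x, g, hx, hg, h1, h2⟩ := (minimal_projection_ker hn hX
      (f := LinearMap.toContinuousLinearMap f) (by simpa using hf0)
      (fun x => by rw [hYeq]; exact LinearMap.mem_ker) hP hmin).2 (hPY.symm.trans hYc)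
    exact exists_linearMap_of_contact_system (by omega) hX hx hg h1 h2
  · rintro ⟨T, hC, hT⟩
    exact exists_relProjConst_eq_of_linearMap hn hX hC hT
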